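/- Let $(W,S)$ be an irreducible affine Weyl group with its set $S$ of simple reflections, i.e. a Coxeter system of one of the types $\tilde A_n$ $(n\ge 1)$, $\tilde B_n$ $(n\ge 3)$, $\tilde C_n$ $(n\ge 2)$, $\tilde D_n$ $(n\ge 4)$, $\tilde E_6,\tilde E_7,\tilde E_8,\tilde F_4,\tilde G_2$, indexed in the standard way, so that a group of type $\tilde X_n$ has $n+1$ simple reflections. The (right) weak order on $W$ is defined by $u\le w$ if and only if $w=us_1\cdots s_k$ for some $s_1,\dots,s_k\in S$ with $\ell(us_1\cdots s_i)=\ell(u)+i$ for all $1\le i\le k$, where $\ell$ is the length function. Let $V(W)$ be its Hasse graph: its vertex set is $W$, and two elements are joined by an undirected edge if and only if one covers the other. For a locally finite graph $G$ (every vertex has finite degree), write $v\sim x$ if $v$ and $x$ are adjacent, and for real functions $f,g$ on the vertices put $$\Delta f(x)=\sum_{v\sim x}(f(v)-f(x)),\qquad \Gamma(f,g)(x)=\tfrac12\sum_{v\sim x}(f(x)-f(v))(g(x)-g(v)),$$ $$\Gamma_2(f)(x)=\tfrac12\,\Delta(\Gamma(f,f))(x)-\Gamma(f,\Delta f)(x).$$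 The discrete Ricci curvature $\mathrm{Ric}(G)$ is the maximal $K\in\mathbb R\cup\{-\infty\}$ such that $\Gamma_2(f)(x)\ge K\,\Gamma(f,f)(x)$ for all real functions $f$ on the vertices and all vertices $x$. Then $V(W)$ is locally finite, and: \begin{itemize} \item for every $n\ge 3$, if $W$ is of type $\tilde A_{n-1}$ (so that $|S|=n$ and the Coxeter graph is a cycle with $n$ vertices), then $\mathrm{Ric}(V(W))=2\cos\left(\frac{2\pi}{n}\left\lceil\frac n2\right\rceil\right)$; \item $\mathrm{Ric}(V(W))=-2\cos\left(\frac{\pi}{|S|}\right)$ if $W$ is of type $\tilde C_n$ $(n\ge 2)$, $\tilde F_4$, $\tilde G_2$ or $\tilde A_1$; \item $-4\le \mathrm{Ric}(V(W))\le -2$ if $W$ is of type $\tilde B_n$ $(n\ge 3)$; \item $-4\le \mathrm{Ric}(V(W))\le -2$ if $W$ is of type $\tilde D_n$ with $n\ge 5$, and $\mathrm{Ric}(V(W))=-3$ if $W$ is of type $\tilde D_4$; \item $\mathrm{Ric}(V(W))=-2.414\ldots$, $-2.36\ldots$, $-2.34\ldots$ if $W$ is of type $\tilde E_6$, $\tilde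 E_7$, $\tilde E_8$ respectively (decimal expansions truncated after the displayed digits). \end{itemize} -/

import Mathlib

namespace WeakOrderCurvature

/-! ### Discrete Ricci curvature of a graph -/

section Curvature

variable {V : Type*}

/-- A graph is locally finite if every vertex has finite degree. -/
def IsLocallyFinite (G : SimpleGraph V) : Prop :=
  ∀ x : V, (G.neighborSet x).Finite

/-- The Laplacian: `Δ f x` is the sum of `f v - f x` over the neighbours `v` of `x`.
The sum is the honest one when `G` is locally finite. -/
noncomputable def laplacian (G : SimpleGraph V) (f : V → ℝ) (x : V) : ℝ :=
  ∑ᶠ v ∈ G.neighborSet x, (f v - f x)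

/-- The operator `Γ(f, g)`. -/
noncomputable def gammaForm (G : SimpleGraph V) (f g : V → ℝ) (x : V) : ℝ :=
  (1 / 2) * ∑ᶠ v ∈ G.neighborSet x, (f x - f v) * (g x - g v)

/-- The operator `Γ₂(f) = ½ Δ(Γ(f, f)) - Γ(f, Δ f)`. -/
noncomputable def gammaTwo (G : SimpleGraph V) (f : V → ℝ) (x : V) : ℝ :=
  (1 / 2) * laplacian G (gammaForm G f f) x - gammaForm G f (laplacian G f) x

/-- The real number `K` is a lower curvature bound: `Γ₂(f)(x) ≥ K Γ(f)(x)` for every real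
function `f` on the vertices and every vertex `x`. -/
def IsCurvatureBound (G : SimpleGraph V) (K : ℝ) : Prop :=
  ∀ (f : V → ℝ) (x : V), K * gammaForm G f f x ≤ gammaTwo G f x

/-- The discrete Ricci curvature of `G`: the largest lower curvature bound, which is `-∞` (that is,
`⊥`) if there is no real lower curvature bound. -/
noncomputable def ricciCurvature (G : SimpleGraph V) : EReal :=
  sSup ((fun K : ℝ => (K : EReal)) '' {K : ℝ | IsCurvatureBound G K})

/-- A real value of the curvature is an attained maximum. -/
theorem ricciCurvature_eq_coe_iff (G : SimpleGraph V) (r : ℝ) :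
    ricciCurvature G = (r : EReal) ↔ IsGreatest {K : ℝ | IsCurvatureBound G K} r := by
  constructor
  · intro h
    have hub : ∀ K : ℝ, IsCurvatureBound G K → K ≤ r := by
      intro K hK
      have h1 : (K : EReal) ≤ ricciCurvature G := le_sSup ⟨K, hK, rfl⟩
      rw [h] at h1
      exact_mod_cast h1
    refine ⟨?_, fun K hK => hub K hK⟩
    have hex : ∀ s : ℝ, s < r → ∃ K : ℝ, IsCurvatureBound G K ∧ s < K := by
      intro s hs
      have h1 : (s : EReal) < ricciCurvature G := by
        rw [h]
        exact_mod_cast hs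
      obtain ⟨_, ⟨K, hK, rfl⟩, hsK⟩ := lt_sSup_iff.1 h1
      exact ⟨K, hK, EReal.coe_lt_coe_iff.1 hsK⟩
    have hlim : Filter.Tendsto (fun n : ℕ => r - 1 / ((n : ℝ) + 1)) Filter.atTop (nhds r) := by
      simpa using (tendsto_const_nhds (x := r)).sub
        (tendsto_one_div_add_atTop_nhds_zero_nat (𝕜 := ℝ))
    have hpos : ∀ (f : V → ℝ) (x : V), 0 ≤ gammaForm G f f x := by
      intro f x
      refine mul_nonneg (by norm_num) (finsum_nonneg fun v => finsum_nonneg fun _ => ?_)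
      exact mul_self_nonneg _
    intro f x
    refine le_of_tendsto (hlim.mul_const _) (Filter.Eventually.of_forall fun n => ?_)
    obtain ⟨K, hK, hlt⟩ := hex (r - 1 / ((n : ℝ) + 1)) (by
      have : (0 : ℝ) < 1 / ((n : ℝ) + 1) := by positivity
      linarith)
    exact (mul_le_mul_of_nonneg_right hlt.le (hpos f x)).trans (hK f x)
  · rintro ⟨h1, h2⟩
    refine le_antisymm (sSup_le ?_) (le_sSup ⟨r, h1, rfl⟩)
    rintro _ ⟨K, hK, rfl⟩
    exact EReal.coe_le_coe_iff.2 (h2 hK)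

end Curvature

/-! ### The weak order graph of a Coxeter system -/

section WeakOrder

variable {B W : Type*} [Group W] {M : CoxeterMatrix B}

/-- The right weak order: `u ≤ w` if `w = u s₁ ⋯ s_k` for simple reflections `s₁, …, s_k` such that
`ℓ(u s₁ ⋯ s_i) = ℓ(u) + i` for all `i ≤ k`. -/
def WeakLE (cs : CoxeterSystem M W) (u w : W) : Prop :=
  ∃ ω : List B, w = u * cs.wordProd ω ∧
    ∀ i : ℕ, i ≤ ω.length → cs.length (u * cs.wordProd (ω.take i)) = cs.length u + i

theorem WeakLE.length_le {cs : CoxeterSystem M W} {u w : W} (h : WeakLE cs u w) :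
    cs.length u ≤ cs.length w := by
  obtain ⟨ω, rfl, h⟩ := h
  have := h ω.length le_rfl
  rw [List.take_length] at this
  omega

/-- The right weak order as a partial order on `W`. -/
abbrev weakOrder (cs : CoxeterSystem M W) : PartialOrder W where
  le := WeakLE cs
  le_refl u := ⟨[], by simp, by simp⟩
  le_trans u v w := by
    rintro ⟨ω, rfl, h⟩ ⟨ω', rfl, h'⟩
    refine ⟨ω ++ ω', by rw [cs.wordProd_append, mul_assoc], fun i hi => ?_⟩
    rcases le_total i ω.length with hle | hle
    · rw [List.take_append_of_le_length hle]
      exact h i hle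
    · obtain ⟨j, rfl⟩ := Nat.exists_eq_add_of_le hle
      rw [List.length_append] at hi
      have h1 := h ω.length le_rfl
      rw [List.take_length] at h1
      have h2 := h' j (by omega)
      rw [List.take_length_add_append, cs.wordProd_append, ← mul_assoc]
      omega
  le_antisymm u w := by
    intro h h'
    have hl := h'.length_le
    obtain ⟨ω, rfl, h⟩ := h
    have h1 := h ω.length le_rfl
    rw [List.take_length] at h1
    have : ω = [] := List.length_eq_zero_iff.1 (by omega)
    subst this
    simp

/-- The weak order graph `V(W)`: the Hasse graph of the right weak order, in which two elements are
adjacent if and only if one of them covers the other. -/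
def weakOrderGraph (cs : CoxeterSystem M W) : SimpleGraph W :=
  letI : PartialOrder W := weakOrder cs
  SimpleGraph.hasse W

end WeakOrder

/-! ### The Coxeter matrices of the (irreducible) affine Weyl groups

As in `CoxeterMatrix`, the entry `0` stands for `∞`. -/

/-- Type `Ã₁`: two generators with `m = ∞`. -/
def affineA₁ : CoxeterMatrix (Fin 2) where
  M := !![1, 0;
          0, 1]
  off_diagonal := by
    intro i j h
    fin_cases i <;> fin_cases j <;> simp_all

/-- The affine type `Ã` with `n ≥ 3` generators: the Coxeter graph is the cycle
`0 - 1 - ⋯ - (n - 1) - 0` with `n` vertices and no labels. -/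
def affineA (n : ℕ) : CoxeterMatrix (Fin n) where
  M := Matrix.of fun i j : Fin n ↦
    if i = j then 1
      else (if (j : ℕ) = (i + 1) % n ∨ (i : ℕ) = (j + 1) % n then 3 else 2)
  isSymm := by unfold Matrix.IsSymm; aesop
  diagonal := by simp
  off_diagonal := by aesop

/-- Type `B̃_n` for `n ≥ 3`, with `n + 1` generators:
```
    0
     \             4
      2 --- 3 ⬝ ⬝ ⬝ --- n
     /
    1
```
where the edge between `n - 1` and `n` carries the label `4`. -/
def affineB (n : ℕ) : CoxeterMatrix (Fin (n + 1)) where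
  M := Matrix.of fun i j : Fin (n + 1) ↦
    if i = j then 1
      else if ((i : ℕ) = 0 ∧ (j : ℕ) = 1) ∨ ((j : ℕ) = 0 ∧ (i : ℕ) = 1) then 2
      else if ((i : ℕ) = 0 ∧ (j : ℕ) = 2) ∨ ((j : ℕ) = 0 ∧ (i : ℕ) = 2) then 3
      else if ((i : ℕ) + 1 = n ∧ (j : ℕ) = n) ∨ ((j : ℕ) + 1 = n ∧ (i : ℕ) = n) then 4
      else if (j : ℕ) + 1 = i ∨ (i : ℕ) + 1 = j then 3 else 2
  isSymm := by
    ext i j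
    simp only [Matrix.transpose_apply, Matrix.of_apply]
    grind
  diagonal := by simp
  off_diagonal := by
    intro i j h
    simp only [Matrix.of_apply]
    grind

/-- Type `C̃_n` for `n ≥ 2`, with `n + 1` generators: the Coxeter graph is the path
`0 - 1 - ⋯ - n`, whose first and last edges carry the label `4`. -/
def affineC (n : ℕ) : CoxeterMatrix (Fin (n + 1)) where
  M := Matrix.of fun i j : Fin (n + 1) ↦
    if i = j then 1
      else if ((i : ℕ) = 0 ∧ (j : ℕ) = 1) ∨ ((j : ℕ) = 0 ∧ (i : ℕ) = 1) then 4
      else if ((i : ℕ) + 1 = n ∧ (j : ℕ) = n) ∨ ((j : ℕ) + 1 = n ∧ (i : ℕ) = n) then 4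
      else if (j : ℕ) + 1 = i ∨ (i : ℕ) + 1 = j then 3 else 2
  isSymm := by
    ext i j
    simp only [Matrix.transpose_apply, Matrix.of_apply]
    grind
  diagonal := by simp
  off_diagonal := by
    intro i j h
    simp only [Matrix.of_apply]
    grind

/-- Type `D̃_n` for `n ≥ 4`, with `n + 1` generators and no labels:
```
    0                     n - 1
     \                   /
      2 --- 3 ⬝ ⬝ ⬝ n - 2
     /                   \
    1                     n
```
-/
def affineD (n : ℕ) : CoxeterMatrix (Fin (n + 1)) where
  M := Matrix.of fun i j : Fin (n + 1) ↦
    if i = j then 1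
      else if ((i : ℕ) = 0 ∧ (j : ℕ) = 1) ∨ ((j : ℕ) = 0 ∧ (i : ℕ) = 1) then 2
      else if ((i : ℕ) = 0 ∧ (j : ℕ) = 2) ∨ ((j : ℕ) = 0 ∧ (i : ℕ) = 2) then 3
      else if ((i : ℕ) + 1 = n ∧ (j : ℕ) = n) ∨ ((j : ℕ) + 1 = n ∧ (i : ℕ) = n) then 2
      else if ((i : ℕ) + 2 = n ∧ (j : ℕ) = n) ∨ ((j : ℕ) + 2 = n ∧ (i : ℕ) = n) then 3
      else if (j : ℕ) + 1 = i ∨ (i : ℕ) + 1 = j then 3 else 2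
  isSymm := by
    ext i j
    simp only [Matrix.transpose_apply, Matrix.of_apply]
    grind
  diagonal := by simp
  off_diagonal := by
    intro i j h
    simp only [Matrix.of_apply]
    grind

/-- Type `Ẽ₆`: the path `0 - 1 - 2 - 3 - 4` with the branch `2 - 5 - 6`, no labels. -/
def affineE₆ : CoxeterMatrix (Fin 7) where
  M := !![1, 3, 2, 2, 2, 2, 2;
          3, 1, 3, 2, 2, 2, 2;
          2, 3, 1, 3, 2, 3, 2;
          2, 2, 3, 1, 3, 2, 2;
          2, 2, 2, 3, 1, 2, 2;
          2, 2, 3, 2, 2, 1, 3;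
          2, 2, 2, 2, 2, 3, 1]
  off_diagonal := by
    intro i j h
    fin_cases i <;> fin_cases j <;> simp_all

/-- Type `Ẽ₇`: the path `0 - 1 - 2 - 3 - 4 - 5 - 6` with the branch `3 - 7`, no labels. -/
def affineE₇ : CoxeterMatrix (Fin 8) where
  M := !![1, 3, 2, 2, 2, 2, 2, 2;
          3, 1, 3, 2, 2, 2, 2, 2;
          2, 3, 1, 3, 2, 2, 2, 2;
          2, 2, 3, 1, 3, 2, 2, 3;
          2, 2, 2, 3, 1, 3, 2, 2;
          2, 2, 2, 2, 3, 1, 3, 2;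
          2, 2, 2, 2, 2, 3, 1, 2;
          2, 2, 2, 3, 2, 2, 2, 1]
  off_diagonal := by
    intro i j h
    fin_cases i <;> fin_cases j <;> simp_all

/-- Type `Ẽ₈`: the path `0 - 1 - 2 - 3 - 4 - 5 - 6 - 7` with the branch `2 - 8`, no labels. -/
def affineE₈ : CoxeterMatrix (Fin 9) where
  M := !![1, 3, 2, 2, 2, 2, 2, 2, 2;
          3, 1, 3, 2, 2, 2, 2, 2, 2;
          2, 3, 1, 3, 2, 2, 2, 2, 3;
          2, 2, 3, 1, 3, 2, 2, 2, 2;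
          2, 2, 2, 3, 1, 3, 2, 2, 2;
          2, 2, 2, 2, 3, 1, 3, 2, 2;
          2, 2, 2, 2, 2, 3, 1, 3, 2;
          2, 2, 2, 2, 2, 2, 3, 1, 2;
          2, 2, 3, 2, 2, 2, 2, 2, 1]
  off_diagonal := by
    intro i j h
    fin_cases i <;> fin_cases j <;> simp_all

/-- Type `F̃₄`: the path on five vertices with labels `3, 3, 4, 3`. -/
def affineF₄ : CoxeterMatrix (Fin 5) where
  M := !![1, 3, 2, 2, 2;
          3, 1, 3, 2, 2;
          2, 3, 1, 4, 2;
          2, 2, 4, 1, 3;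
          2, 2, 2, 3, 1]
  off_diagonal := by
    intro i j h
    fin_cases i <;> fin_cases j <;> simp_all

/-- Type `G̃₂`: the path on three vertices with labels `3, 6`. -/
def affineG₂ : CoxeterMatrix (Fin 3) where
  M := !![1, 3, 2;
          3, 1, 6;
          2, 6, 1]
  off_diagonal := by
    intro i j h
    fin_cases i <;> fin_cases j <;> simp_all

/-- The Coxeter matrices of the irreducible affine Weyl groups (with numbered generators). -/
inductive IsAffineWeyl : {m : ℕ} → CoxeterMatrix (Fin m) → Prop
  | A₁ : IsAffineWeyl affineA₁
  | A (n : ℕ) (hn : 3 ≤ n) : IsAffineWeyl (affineA n)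
  | B (n : ℕ) (hn : 3 ≤ n) : IsAffineWeyl (affineB n)
  | C (n : ℕ) (hn : 2 ≤ n) : IsAffineWeyl (affineC n)
  | D (n : ℕ) (hn : 4 ≤ n) : IsAffineWeyl (affineD n)
  | E₆ : IsAffineWeyl affineE₆
  | E₇ : IsAffineWeyl affineE₇
  | E₈ : IsAffineWeyl affineE₈
  | F₄ : IsAffineWeyl affineF₄
  | G₂ : IsAffineWeyl affineG₂

/-- The Coxeter matrices of the affine types `C̃_n`, `F̃₄`, `G̃₂` and `Ã₁`, whose Coxeter graph is a
path. -/
inductive IsLinearAffine : {m : ℕ} → CoxeterMatrix (Fin m) → Prop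
  | C (n : ℕ) (hn : 2 ≤ n) : IsLinearAffine (affineC n)
  | F₄ : IsLinearAffine affineF₄
  | G₂ : IsLinearAffine affineG₂
  | A₁ : IsLinearAffine affineA₁

end WeakOrderCurvature

namespace WeakOrderCurvature

/-! ### The weak order graph is the Cayley graph -/

section CayleyGraph

variable {B W : Type*} [Group W] {M : CoxeterMatrix B}

/-! The weak order graph is the Cayley graph of `(W, S)`, so `Γ` and `Γ₂` at `x` involve only the
increments `g i = f (x sᵢ) - f x` and `h i j = f (x sᵢ sⱼ) - f x`. Here `2Γ = ∑ (g i)²` and `2Γ₂ = ½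
∑ ((h i j - 2 g i)² - (g i - g j)²)`. Minimise over `h` for fixed `g`: the diagonal gives `2 ∑ (g
i)²`, commuting pairs give nothing, and each edge of the Coxeter graph gives `-(g i - g j)²`. Hence
the curvature is `2 - λ`, with `λ` the largest Laplace eigenvalue of the unlabelled Coxeter graph
(`isCurvatureBound_weakOrderGraph_iff`).

For the minimum to be attained, products `sᵢ sⱼ` must coincide only when commutation forces it. This
is seen on an orbit of an affine reflection representation, from which `extremalFunction` is built.

It remains to bound `λ`. A positive `v` with signless Laplacian at most `μ v` gives `λ ≤ μ`
(`dirichletEnergy_le`); test vectors give lower bounds. On a bipartite graph, alternating the signs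
of a positive signless eigenvector makes both bounds agree. The odd cycle is not bipartite:
translating by a top eigenvector first makes the function vanish at one vertex, which reduces the
problem to a path. -/

theorem WeakLE.eq_of_length_eq {cs : CoxeterSystem M W} {u w : W} (h : WeakLE cs u w)
    (hl : cs.length u = cs.length w) : u = w := by
  obtain ⟨ω, rfl, h⟩ := h
  have h1 := h ω.length le_rfl
  rw [List.take_length] at h1
  have : ω = [] := List.length_eq_zero_iff.1 (by omega)
  simp [this]

theorem weakLE_mul_simple {cs : CoxeterSystem M W} {u : W} {i : B}
    (h : cs.length (u * cs.simple i) = cs.length u + 1) : WeakLE cs u (u * cs.simple i) := by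
  refine ⟨[i], by simp, fun k hk => ?_⟩
  obtain rfl | rfl : k = 0 ∨ k = 1 := by simp at hk; omega
  · simp
  · simpa using h

theorem weakOrder_covBy_mul_simple {cs : CoxeterSystem M W} {u : W} {i : B}
    (h : cs.length (u * cs.simple i) = cs.length u + 1) :
    letI := weakOrder cs
    u ⋖ u * cs.simple i := by
  let _ := weakOrder cs
  have hle : u ≤ u * cs.simple i := weakLE_mul_simple h
  refine ⟨lt_of_le_of_ne hle fun h' => ?_, fun c hc hc' => ?_⟩
  · rw [← h'] at h
    omega
  · have h1 := WeakLE.length_le (cs := cs) hc.le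
    have h2 := WeakLE.length_le (cs := cs) hc'.le
    by_cases h3 : cs.length u = cs.length c
    · exact hc.ne (WeakLE.eq_of_length_eq hc.le h3)
    · exact hc'.ne (WeakLE.eq_of_length_eq hc'.le (by omega))

theorem exists_eq_mul_simple_of_covBy {cs : CoxeterSystem M W} {u w : W}
    (h : letI := weakOrder cs; u ⋖ w) : ∃ i, w = u * cs.simple i := by
  let _ := weakOrder cs
  have h : u ⋖ w := h
  obtain ⟨ω, rfl, hω⟩ := show WeakLE cs u w from h.1.le
  cases ω with
  | nil => simp at h
  | cons i ω =>
    refine ⟨i, ?_⟩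
    have h1 := hω 1 (by simp)
    simp only [List.take_succ_cons, List.take_zero, cs.wordProd_singleton] at h1
    have hlt : u < u * cs.simple i := (weakOrder_covBy_mul_simple h1).1
    have hle : u * cs.simple i ≤ u * cs.wordProd (i :: ω) := by
      refine ⟨ω, by rw [cs.wordProd_cons, mul_assoc], fun k hk => ?_⟩
      have h2 := hω (k + 1) (by simpa using hk)
      rw [List.take_succ_cons, cs.wordProd_cons, ← mul_assoc] at h2
      omega
    rcases hle.lt_or_eq with h3 | h3
    · exact absurd h3 (h.2 hlt)
    · exact h3.symm

/-- Right multiplication by a simple reflection changes the length by exactly one, so one of `u`, `u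
s` lies below the other with no room between; conversely the first step of a chain realising a cover
must already be the whole chain. -/
theorem weakOrderGraph_adj (cs : CoxeterSystem M W) (u w : W) :
    (weakOrderGraph cs).Adj u w ↔ ∃ i, u * cs.simple i = w := by
  let _ := weakOrder cs
  constructor
  · rintro (h | h)
    · obtain ⟨i, rfl⟩ := exists_eq_mul_simple_of_covBy h
      exact ⟨i, rfl⟩
    · obtain ⟨i, rfl⟩ := exists_eq_mul_simple_of_covBy h
      exact ⟨i, by simp⟩
  · rintro ⟨i, rfl⟩
    rcases cs.length_mul_simple u i with h | h
    · exact Or.inl (weakOrder_covBy_mul_simple h)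
    · refine Or.inr ?_
      have := weakOrder_covBy_mul_simple (cs := cs) (u := u * cs.simple i) (i := i) (by simp [h])
      simpa using this

theorem neighborSet_weakOrderGraph (cs : CoxeterSystem M W) (u : W) :
    (weakOrderGraph cs).neighborSet u = Set.range fun i => u * cs.simple i := by
  ext w
  exact weakOrderGraph_adj cs u w

theorem isLocallyFinite_weakOrderGraph [Finite B] (cs : CoxeterSystem M W) :
    IsLocallyFinite (weakOrderGraph cs) := by
  intro u
  rw [neighborSet_weakOrderGraph]
  exact Set.finite_range _

end CayleyGraph

/-! ### The bottom of the Laplace spectrum of a finite graph -/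

section Energy

variable {B : Type*} [Fintype B]

/-- The Dirichlet energy: the sum of `(a i - a j) ^ 2` over the edges `ij`. -/
noncomputable def dirichletEnergy (G : SimpleGraph B) [DecidableRel G.Adj] (a : B → ℝ) : ℝ :=
  (1 / 2) * ∑ i, ∑ j, if G.Adj i j then (a i - a j) ^ 2 else 0

end Energy

/-- The Coxeter graph of a Coxeter matrix, without its labels. -/
def coxeterGraph {B : Type*} (M : CoxeterMatrix B) : SimpleGraph B where
  Adj i j := i ≠ j ∧ M i j ≠ 2
  symm := ⟨fun i j h => ⟨h.1.symm, by rw [M.symmetric]; exact h.2⟩⟩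
  loopless := ⟨fun _ h => h.1 rfl⟩

instance {B : Type*} [DecidableEq B] (M : CoxeterMatrix B) : DecidableRel (coxeterGraph M).Adj :=
  fun i j => inferInstanceAs (Decidable (i ≠ j ∧ M i j ≠ 2))

/-! ### Curvature operators on the Cayley graph and the lower bound for `Γ₂` -/

section Curvature

variable {B W : Type*} [Group W] [Fintype B] {M : CoxeterMatrix B}

theorem finsum_mem_neighborSet (cs : CoxeterSystem M W)
    (hinj : Function.Injective cs.simple) (F : W → ℝ) (x : W) :
    ∑ᶠ v ∈ (weakOrderGraph cs).neighborSet x, F v = ∑ i, F (x * cs.simple i) := by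
  rw [neighborSet_weakOrderGraph, finsum_mem_range, finsum_eq_sum_of_fintype]
  exact fun i j h => hinj (mul_left_cancel h)

theorem gammaForm_weakOrderGraph (cs : CoxeterSystem M W)
    (hinj : Function.Injective cs.simple) (f : W → ℝ) (x : W) :
    2 * gammaForm (weakOrderGraph cs) f f x = ∑ i, (f (x * cs.simple i) - f x) ^ 2 := by
  rw [gammaForm, finsum_mem_neighborSet cs hinj, ← mul_assoc]
  norm_num
  exact Finset.sum_congr rfl fun i _ => by ring

theorem gammaTwo_weakOrderGraph (cs : CoxeterSystem M W)
    (hinj : Function.Injective cs.simple) (f : W → ℝ) (x : W) :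
    2 * gammaTwo (weakOrderGraph cs) f x = (1 / 2) * ∑ i, ∑ j,
      ((f (x * cs.simple i * cs.simple j) - f x - 2 * (f (x * cs.simple i) - f x)) ^ 2 -
        ((f (x * cs.simple i) - f x) - (f (x * cs.simple j) - f x)) ^ 2) := by
  set g : B → ℝ := fun i => f (x * cs.simple i) - f x with hg
  set h : B → B → ℝ := fun i j => f (x * cs.simple i * cs.simple j) - f x with hh
  change _ = (1 / 2) * ∑ i, ∑ j, ((h i j - 2 * g i) ^ 2 - (g i - g j) ^ 2)
  simp only [gammaTwo, laplacian, gammaForm, finsum_mem_neighborSet cs hinj]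
  have e1 (P Q : B → ℝ) : 2 * (1 / 2 * ∑ i, P i - 1 / 2 * ∑ i, Q i) = ∑ i, (P i - Q i) := by
    rw [Finset.sum_sub_distrib]
    ring
  rw [e1]
  refine Eq.trans (Finset.sum_congr rfl fun i _ => ?_) (Finset.mul_sum _ _ _).symm
  simp only [Finset.mul_sum, ← Finset.sum_sub_distrib]
  refine Finset.sum_congr rfl fun j _ => ?_
  simp only [hg, hh]
  ring

/-- Minimisation over the sphere of radius two: `h i i = 0` is forced by `sᵢ² = 1`, `h i j = h j i`
by commutation, and for non-commuting pairs the square `(h i j - 2 g i)²` is simply dropped. -/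
theorem le_gammaTwo_weakOrderGraph [DecidableEq B] (cs : CoxeterSystem M W)
    (hinj : Function.Injective cs.simple) (f : W → ℝ) (x : W) :
    2 * ∑ i, (f (x * cs.simple i) - f x) ^ 2 -
        dirichletEnergy (coxeterGraph M) (fun i => f (x * cs.simple i) - f x) ≤
      2 * gammaTwo (weakOrderGraph cs) f x := by
  rw [gammaTwo_weakOrderGraph cs hinj, dirichletEnergy]
  set g : B → ℝ := fun i => f (x * cs.simple i) - f x with hg
  set h : B → B → ℝ := fun i j => f (x * cs.simple i * cs.simple j) - f x with hh
  change 2 * ∑ i, g i ^ 2 - 1 / 2 * ∑ i, ∑ j, (if (coxeterGraph M).Adj i j then (g i - g j) ^ 2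
    else 0) ≤ (1 / 2) * ∑ i, ∑ j, ((h i j - 2 * g i) ^ 2 - (g i - g j) ^ 2)
  have hself : ∀ i, h i i = 0 := fun i => by simp [hh]
  have hcomm : ∀ i j, M i j = 2 → h i j = h j i := fun i j hij => by
    have := cs.simple_mul_simple_pow i j
    rw [hij, sq] at this
    have h2 : cs.simple i * cs.simple j = cs.simple j * cs.simple i := by
      rw [mul_eq_one_iff_eq_inv, mul_inv_rev, cs.inv_simple, cs.inv_simple] at this
      exact this
    simp only [hh, mul_assoc, h2]
  have hdiag : ∑ i, ∑ j, (if i = j then 4 * g i ^ 2 else 0) = 4 * ∑ i, g i ^ 2 := by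
    simp [Finset.mul_sum]
  have hswap (F : B → B → ℝ) : 2 * ∑ i, ∑ j, F i j = ∑ i, ∑ j, (F i j + F j i) := by
    simp only [Finset.sum_add_distrib]
    rw [Finset.sum_comm (f := fun i j => F j i)]
    ring
  have hmain : ∑ i, ∑ j, ((if i = j then 4 * g i ^ 2 else 0) -
      (if (coxeterGraph M).Adj i j then (g i - g j) ^ 2 else 0)) ≤
        ∑ i, ∑ j, ((h i j - 2 * g i) ^ 2 - (g i - g j) ^ 2) := by
    -- For a commuting pair the bound holds only for the sum of the terms `(i, j)` and `(j, i)`,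
    -- with equality at `h i j = g i + g j`; hence the double sum is symmetrised first.
    refine le_of_mul_le_mul_left ?_ (two_pos (α := ℝ))
    rw [hswap, hswap]
    refine Finset.sum_le_sum fun i _ => Finset.sum_le_sum fun j _ => ?_
    by_cases hij : i = j
    · subst hij
      simp [hself]
      linarith [sq_nonneg (g i)]
    · by_cases hM : M i j = 2
      · have h1 : ¬ (coxeterGraph M).Adj i j := fun h => h.2 hM
        have h2 : ¬ (coxeterGraph M).Adj j i := fun h => h1 h.symm
        simp only [hij, Ne.symm hij, h1, h2, if_false, hcomm i j hM]
        linarith [sq_nonneg (h j i - g i - g j)]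
      · have h1 : (coxeterGraph M).Adj i j := ⟨hij, hM⟩
        simp only [hij, Ne.symm hij, h1, h1.symm, if_false, if_true]
        linarith [sq_nonneg (h i j - 2 * g i), sq_nonneg (h j i - 2 * g j)]
  simp only [Finset.sum_sub_distrib, hdiag] at hmain ⊢
  linarith

end Curvature
/-! ### An affine reflection representation

The vector `x` stands for the point `λ - ∑ i, x i • α i`, where `λ` is a point whose pairing with
every simple coroot is `1`. -/

section Representation

variable {B : Type*} [Fintype B] [DecidableEq B]

/-- The pairing of the point with coordinates `x` with the `s`-th simple coroot. -/
def corootPairing (c : B → B → ℝ) (s : B) (x : B → ℝ) : ℝ := 1 - ∑ i, x i * c i s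

/-- The affine reflection in the `s`-th simple root. -/
def affineReflection (c : B → B → ℝ) (s : B) (x : B → ℝ) : B → ℝ :=
  x + Pi.single s (corootPairing c s x)

theorem corootPairing_add (c : B → B → ℝ) (s t : B) (x : B → ℝ) (p : ℝ) :
    corootPairing c s (x + Pi.single t p) = corootPairing c s x - p * c t s := by
  simp [corootPairing, add_mul, Finset.sum_add_distrib, Pi.single_apply]
  ring

/-- The reflections in `s` and `t` preserve the plane through `x` spanned by these two coordinates,
so a rank two relation becomes a computation with the coefficients `p`, `q`. -/
theorem affineReflection_fst {c : B → B → ℝ} {s : B} (t : B) (hs : c s s = 2)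
    (x : B → ℝ) (p q : ℝ) :
    affineReflection c s (x + Pi.single s p + Pi.single t q) =
      x + Pi.single s (corootPairing c s x - p - c t s * q) + Pi.single t q := by
  rw [affineReflection, corootPairing_add, corootPairing_add, hs, add_right_comm (x + _) (Pi.single t q),
    add_assoc x, ← Pi.single_add]
  congr 3
  ring

theorem affineReflection_snd {c : B → B → ℝ} {t : B} (s : B) (ht : c t t = 2)
    (x : B → ℝ) (p q : ℝ) :
    affineReflection c t (x + Pi.single s p + Pi.single t q) =
      x + Pi.single s p + Pi.single t (corootPairing c t x - q - c s t * p) := by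
  rw [add_right_comm, affineReflection_fst s ht, add_right_comm]

theorem affineReflection_involutive {c : B → B → ℝ} {s : B} (hs : c s s = 2) :
    Function.Involutive (affineReflection c s) := by
  intro x
  have h := affineReflection_fst s hs x
  rw [show x = x + Pi.single s 0 + Pi.single s 0 by simp, h, h]
  simp

theorem affineReflection_comp_iterate {c : B → B → ℝ} {s t : B} (hs : c s s = 2) (ht : c t t = 2)
    {m : ℕ} (h : (m = 2 ∧ c s t = 0 ∧ c t s = 0) ∨ (m = 3 ∧ c s t = -1 ∧ c t s = -1) ∨
      (m = 4 ∧ c s t = -1 ∧ c t s = -2) ∨ (m = 4 ∧ c s t = -2 ∧ c t s = -1)) :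
    (affineReflection c s ∘ affineReflection c t)^[m] = id := by
  have h1 := affineReflection_fst t hs
  have h2 := affineReflection_snd s ht
  ext1 x
  rw [show x = x + Pi.single s 0 + Pi.single t 0 by simp]
  rcases h with ⟨rfl, h3, h4⟩ | ⟨rfl, h3, h4⟩ | ⟨rfl, h3, h4⟩ | ⟨rfl, h3, h4⟩ <;>
  · simp only [Function.iterate_succ, Function.iterate_zero, Function.comp_apply, h1, h2, id]
    rw [h3, h4]
    congr 1
    · congr 2
      ring
    · congr 1
      ring

end Representation

/-- Every edge of the Coxeter diagram carries one of the labels `3, 4, 6, ∞`. -/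
def IsCrystallographic {m : ℕ} (M : CoxeterMatrix (Fin m)) : Prop :=
  ∀ i j, M i j ∈ ({0, 1, 2, 3, 4, 6} : Finset ℕ)

/-- A generalised Cartan matrix, with the same zeros as that of `M`, whose reflections satisfy the
Coxeter relations of `M`. -/
def cartanEntry {m : ℕ} (M : CoxeterMatrix (Fin m)) (i j : Fin m) : ℝ :=
  if i = j then 2 else if M i j = 2 then 0 else if M i j = 4 ∧ i < j then -2 else -1

theorem cartanEntry_self {m : ℕ} (M : CoxeterMatrix (Fin m)) (i : Fin m) :
    cartanEntry M i i = 2 := by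
  simp [cartanEntry]

/-- The affine reflection attached to a simple reflection, as a permutation. -/
noncomputable def simplePerm {m : ℕ} (M : CoxeterMatrix (Fin m)) (i : Fin m) :
    Equiv.Perm (Fin m → ℝ) :=
  (affineReflection_involutive (cartanEntry_self M i)).toPerm

theorem simplePerm_apply {m : ℕ} (M : CoxeterMatrix (Fin m)) (i : Fin m) (x : Fin m → ℝ) :
    simplePerm M i x = affineReflection (cartanEntry M) i x := rfl

theorem isLiftable_simplePerm {m : ℕ} {M : CoxeterMatrix (Fin m)}
    (hM : IsCrystallographic M) : M.IsLiftable (simplePerm M) := by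
  have hd := cartanEntry_self M
  have hpow (i j : Fin m) (n : ℕ) (h : (affineReflection (cartanEntry M) i ∘
      affineReflection (cartanEntry M) j)^[n] = id) :
      (simplePerm M i * simplePerm M j) ^ n = 1 := by
    ext1 x
    rw [← Equiv.Perm.iterate_eq_pow]
    exact congrFun h x
  intro i j
  by_cases hij : i = j
  · subst hij
    rw [M.diagonal]
    exact hpow _ _ _ ((affineReflection_involutive (hd i)).comp_self)
  have hji := Ne.symm hij
  have h := hM i j
  have h' := M.symmetric i j
  simp only [Finset.mem_insert, Finset.mem_singleton] at h
  rcases h with h | h | h | h | h | h <;> rw [h] at h'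
  -- The entry `0` encodes `∞`, so there is no relation to check.
  · rw [h, pow_zero]
  · exact absurd h (M.off_diagonal i j hij)
  · rw [h]
    refine hpow _ _ _ (affineReflection_comp_iterate (hd i) (hd j) ?_)
    simp [cartanEntry, hij, hji, h, ← h']
  · rw [h]
    refine hpow _ _ _ (affineReflection_comp_iterate (hd i) (hd j) ?_)
    simp [cartanEntry, hij, hji, h, ← h']
  · rw [h]
    refine hpow _ _ _ (affineReflection_comp_iterate (hd i) (hd j) ?_)
    rcases lt_or_gt_of_ne hij with hlt | hlt <;>
    simp [cartanEntry, hij, hji, h, ← h', hlt, hlt.not_gt]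
  -- The Cartan entries for the label `6` are those of the label `3`: a product of order dividing
  -- `3` still satisfies the relation, and only the zero pattern of the matrix matters later.
  · rw [h, show 6 = 3 * 2 by rfl, pow_mul,
      hpow _ _ _ (affineReflection_comp_iterate (hd i) (hd j) ?_), one_pow]
    simp [cartanEntry, hij, hji, h, ← h']

/-! ### The orbit of the base point and sharpness of the bound -/

section Orbit

variable {m : ℕ} {W : Type*} [Group W] {M : CoxeterMatrix (Fin m)}

/-- The coordinates of the orbit of the base point. -/
noncomputable def orbitPoint (cs : CoxeterSystem M W) (hM : IsCrystallographic M) (w : W) :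
    Fin m → ℝ :=
  cs.lift ⟨_, isLiftable_simplePerm hM⟩ w 0

theorem orbitPoint_one (cs : CoxeterSystem M W) (hM : IsCrystallographic M) :
    orbitPoint cs hM 1 = 0 := by
  simp [orbitPoint]

theorem orbitPoint_simple (cs : CoxeterSystem M W) (hM : IsCrystallographic M) (i : Fin m) :
    orbitPoint cs hM (cs.simple i) = Pi.single i 1 := by
  simp [orbitPoint, simplePerm_apply, affineReflection, corootPairing]

theorem orbitPoint_simple_mul_simple (cs : CoxeterSystem M W) (hM : IsCrystallographic M)
    (i j : Fin m) : orbitPoint cs hM (cs.simple i * cs.simple j) =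
      Pi.single j 1 + Pi.single i (1 - cartanEntry M j i) := by
  have h := orbitPoint_simple cs hM j
  rw [orbitPoint] at h ⊢
  rw [map_mul, cs.lift_apply_simple, Equiv.Perm.mul_apply, h]
  simp [simplePerm_apply, affineReflection, corootPairing, Pi.single_apply]

theorem simple_injective (cs : CoxeterSystem M W) (hM : IsCrystallographic M) :
    Function.Injective cs.simple := by
  intro i j hij
  have h := congrFun (orbitPoint_simple cs hM i) i
  rw [hij, orbitPoint_simple, Pi.single_apply] at h
  by_contra hne
  simp [hne] at h

open Classical in
/-- A function on `W` with prescribed values `a` at the simple reflections, for which the lower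
bound of `le_gammaTwo_weakOrderGraph` is attained at `1`. -/
noncomputable def extremalFunction (cs : CoxeterSystem M W) (hM : IsCrystallographic M)
    (a : Fin m → ℝ) (w : W) : ℝ :=
  if ∃ i, 1 < orbitPoint cs hM w i then
    ∑ i, if 1 < orbitPoint cs hM w i then 2 * a i else 0
  else ∑ i, a i * orbitPoint cs hM w i

theorem extremalFunction_one (cs : CoxeterSystem M W) (hM : IsCrystallographic M)
    (a : Fin m → ℝ) : extremalFunction cs hM a 1 = 0 := by
  simp [extremalFunction, orbitPoint_one]

theorem extremalFunction_simple (cs : CoxeterSystem M W) (hM : IsCrystallographic M)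
    (a : Fin m → ℝ) (i : Fin m) : extremalFunction cs hM a (cs.simple i) = a i := by
  have h : ¬ ∃ j, 1 < (Pi.single i 1 : Fin m → ℝ) j := by
    rintro ⟨j, hj⟩
    rw [Pi.single_apply] at hj
    split_ifs at hj <;> linarith
  rw [extremalFunction, orbitPoint_simple, if_neg h]
  simp [Pi.single_apply]

/-- For a non-commuting pair, `i` is the only coordinate of the orbit point of `sᵢ sⱼ` exceeding
`1`, since `1 - cartanEntry M j i ≥ 2`; so the first letter can be read off. For a commuting pair
all coordinates are at most `1` and the linear branch applies. Both values are the minimisers of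
`Γ₂`. -/
theorem extremalFunction_simple_mul_simple (cs : CoxeterSystem M W) (hM : IsCrystallographic M)
    (a : Fin m → ℝ) {i j : Fin m} (hij : i ≠ j) :
    extremalFunction cs hM a (cs.simple i * cs.simple j) =
      if M i j = 2 then a i + a j else 2 * a i := by
  have hval : ∀ k, (Pi.single j 1 + Pi.single i (1 - cartanEntry M j i) : Fin m → ℝ) k =
      if k = i then 1 - cartanEntry M j i else if k = j then 1 else 0 := by
    intro k
    rw [Pi.add_apply, Pi.single_apply, Pi.single_apply]
    split_ifs with h1 h2 <;> simp_all
  simp only [extremalFunction, orbitPoint_simple_mul_simple, hval]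
  by_cases hM2 : M i j = 2
  · have hc : cartanEntry M j i = 0 := by simp [cartanEntry, M.symmetric j i, hM2, hij.symm]
    rw [if_pos hM2, if_neg]
    · simp only [hc, sub_zero, mul_ite, mul_one, mul_zero]
      rw [Finset.sum_congr rfl (g := fun k => (if k = i then a k else 0) +
        if k = j then a k else 0)]
      · simp [Finset.sum_add_distrib]
      · intro k _
        split_ifs with h1 h2 <;> simp_all
    · rintro ⟨k, hk⟩
      rw [hc] at hk
      split_ifs at hk <;> linarith
  · have hc : cartanEntry M j i < 0 := by
      simp only [cartanEntry, M.symmetric j i, hM2, hij.symm, if_false]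
      split_ifs <;> norm_num
    have hlt : ∀ k, 1 < (if k = i then 1 - cartanEntry M j i else if k = j then 1 else 0) ↔
        k = i := by
      intro k
      split_ifs with h1 h2 <;> simp [h1]
      linarith
    simp only [hlt, if_neg hM2]
    simp

theorem isCurvatureBound_weakOrderGraph_iff (cs : CoxeterSystem M W) (hM : IsCrystallographic M)
    (K : ℝ) : IsCurvatureBound (weakOrderGraph cs) K ↔
      ∀ a : Fin m → ℝ, dirichletEnergy (coxeterGraph M) a ≤ (2 - K) * ∑ i, a i ^ 2 := by
  have hinj := simple_injective cs hM
  constructor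
  · intro h a
    have h1 := h (extremalFunction cs hM a) 1
    have h2 := gammaTwo_weakOrderGraph cs hinj (extremalFunction cs hM a) 1
    have h3 := gammaForm_weakOrderGraph cs hinj (extremalFunction cs hM a) 1
    simp only [one_mul, extremalFunction_one, extremalFunction_simple, sub_zero] at h2 h3
    -- Term by term: the diagonal contributes `4 (a i)²`, the two squares cancel for a commuting
    -- pair, and the first square vanishes on an edge.
    have h4 : ∑ i, ∑ j, ((extremalFunction cs hM a (cs.simple i * cs.simple j) - 2 * a i) ^ 2 -
        (a i - a j) ^ 2) = 4 * ∑ i, a i ^ 2 - 2 * dirichletEnergy (coxeterGraph M) a := by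
      have hdiag : 4 * ∑ i, a i ^ 2 = ∑ i, ∑ j, (if i = j then 4 * a i ^ 2 else 0) := by
        simp [Finset.mul_sum]
      rw [dirichletEnergy, hdiag, ← mul_assoc, show (2 : ℝ) * (1 / 2) = 1 by norm_num, one_mul]
      simp only [← Finset.sum_sub_distrib]
      refine Finset.sum_congr rfl fun i _ => Finset.sum_congr rfl fun j _ => ?_
      by_cases hij : i = j
      · subst hij
        simp [extremalFunction_one]
        ring
      · rw [extremalFunction_simple_mul_simple cs hM a hij]
        by_cases hM2 : M i j = 2
        · have : ¬ (coxeterGraph M).Adj i j := fun h => h.2 hM2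
          simp only [hM2, this, hij, if_true, if_false]
          ring
        · have : (coxeterGraph M).Adj i j := ⟨hij, hM2⟩
          simp [hM2, this, hij]
    rw [h4] at h2
    rw [show gammaForm (weakOrderGraph cs) _ _ 1 = (∑ i, a i ^ 2) / 2 by linarith] at h1
    linarith
  · intro h f x
    have h1 := le_gammaTwo_weakOrderGraph cs hinj f x
    have h2 := gammaForm_weakOrderGraph cs hinj f x
    have h3 := h fun i => f (x * cs.simple i) - f x
    rw [← h2] at h1 h3
    linarith

end Orbit
-- Bounds for the largest Laplace eigenvalue
section Spectrum

variable {B : Type*} [Fintype B] (G : SimpleGraph B) [DecidableRel G.Adj]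

/-- Green's formula: summation by parts on the graph. -/
theorem half_sum_adj_mul (a w : B → ℝ) :
    (1 / 2) * ∑ i, ∑ j, (if G.Adj i j then (a i - a j) * (w i - w j) else 0) =
      ∑ i, a i * ∑ j, if G.Adj i j then w i - w j else 0 := by
  have h1 : ∑ i, ∑ j, (if G.Adj i j then (a i - a j) * (w i - w j) else 0) =
      ∑ i, ∑ j, (if G.Adj i j then a i * (w i - w j) else 0) +
        ∑ i, ∑ j, (if G.Adj i j then a j * (w j - w i) else 0) := by
    simp only [← Finset.sum_add_distrib]
    refine Finset.sum_congr rfl fun i _ => Finset.sum_congr rfl fun j _ => ?_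
    split_ifs <;> ring
  have h2 : ∑ i, ∑ j, (if G.Adj i j then a j * (w j - w i) else 0) =
      ∑ i, ∑ j, (if G.Adj i j then a i * (w i - w j) else 0) := by
    rw [Finset.sum_comm]
    simp only [G.adj_comm]
  rw [h1, h2, ← two_mul, ← mul_assoc]
  simp only [Finset.mul_sum, mul_ite, mul_zero]
  norm_num

theorem dirichletEnergy_eq_sum (a : B → ℝ) :
    dirichletEnergy G a = ∑ i, a i * ∑ j, if G.Adj i j then a i - a j else 0 := by
  rw [← half_sum_adj_mul, dirichletEnergy]
  simp only [sq]

theorem dirichletEnergy_of_eigenvector {w : B → ℝ} {μ : ℝ}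
    (hw : ∀ i, ∑ j, (if G.Adj i j then w i - w j else 0) = μ * w i) :
    dirichletEnergy G w = μ * ∑ i, w i ^ 2 := by
  rw [dirichletEnergy_eq_sum, Finset.mul_sum]
  refine Finset.sum_congr rfl fun i _ => ?_
  rw [hw]
  ring

/-- The form `μ * ∑ i, a i ^ 2 - dirichletEnergy G a` is invariant under translations by
eigenvectors for the eigenvalue `μ`. -/
theorem sub_dirichletEnergy_sub_smul {w : B → ℝ} {μ : ℝ}
    (hw : ∀ i, ∑ j, (if G.Adj i j then w i - w j else 0) = μ * w i) (a : B → ℝ) (t : ℝ) :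
    μ * ∑ i, (a i - t * w i) ^ 2 - dirichletEnergy G (fun i => a i - t * w i) =
      μ * ∑ i, a i ^ 2 - dirichletEnergy G a := by
  have h1 := half_sum_adj_mul G a w
  simp only [hw] at h1
  have h2 := dirichletEnergy_of_eigenvector G hw
  have h3 : dirichletEnergy G (fun i => a i - t * w i) = dirichletEnergy G a -
      2 * t * ((1 / 2) * ∑ i, ∑ j, (if G.Adj i j then (a i - a j) * (w i - w j) else 0)) +
        t ^ 2 * dirichletEnergy G w := by
    simp only [dirichletEnergy, Finset.mul_sum, ← Finset.sum_add_distrib,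
      ← Finset.sum_sub_distrib]
    refine Finset.sum_congr rfl fun i _ => Finset.sum_congr rfl fun j _ => ?_
    split_ifs <;> ring
  have h4 : ∑ i, (a i - t * w i) ^ 2 = ∑ i, a i ^ 2 - 2 * t * ∑ i, a i * w i +
      t ^ 2 * ∑ i, w i ^ 2 := by
    simp only [Finset.mul_sum, ← Finset.sum_add_distrib, ← Finset.sum_sub_distrib]
    exact Finset.sum_congr rfl fun i _ => by ring
  have h5 : ∑ i, a i * (μ * w i) = μ * ∑ i, a i * w i := by
    rw [Finset.mul_sum]
    exact Finset.sum_congr rfl fun i _ => by ring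
  rw [h3, h1, h2, h4, h5]
  ring

/-- A Perron-type bound for the largest Laplace eigenvalue by a nonnegative subsolution of the
signless Laplacian. -/
theorem dirichletEnergy_le {v : B → ℝ} {μ : ℝ} (hv : ∀ i, 0 ≤ v i)
    (h : ∀ i, 0 < v i → ∑ j, (if G.Adj i j then v i + v j else 0) ≤ μ * v i) {a : B → ℝ}
    (ha : ∀ i, v i = 0 → a i = 0) : dirichletEnergy G a ≤ μ * ∑ i, a i ^ 2 := by
  -- When both weights are positive the difference of the two sides is `(v j * a i + v i * a j)² /
  -- (v i * v j)`. Where `v` vanishes so does `a`, and division by zero gives `0`.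
  have key : ∀ i j, (a i - a j) ^ 2 ≤
      (v i + v j) / v i * a i ^ 2 + (v j + v i) / v j * a j ^ 2 := by
    intro i j
    rcases (hv i).eq_or_lt with hi | hi
    · rcases (hv j).eq_or_lt with hj | hj
      · simp [ha i hi.symm, ha j hj.symm]
      · simp [ha i hi.symm, ← hi, hj.ne']
    · rcases (hv j).eq_or_lt with hj | hj
      · simp [ha j hj.symm, ← hj, hi.ne']
      · have : (v i + v j) / v i * a i ^ 2 + (v j + v i) / v j * a j ^ 2 - (a i - a j) ^ 2 =
            (v j * a i + v i * a j) ^ 2 / (v i * v j) := by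
          field_simp
          ring
        have h2 : 0 ≤ (v j * a i + v i * a j) ^ 2 / (v i * v j) := by positivity
        linarith
  have hsymm : ∑ i, ∑ j, (if G.Adj i j then (v j + v i) / v j * a j ^ 2 else 0) =
      ∑ i, ∑ j, (if G.Adj i j then (v i + v j) / v i * a i ^ 2 else 0) := by
    rw [Finset.sum_comm]
    simp only [G.adj_comm]
  calc dirichletEnergy G a
      ≤ (1 / 2) * ∑ i, ∑ j, ((if G.Adj i j then (v i + v j) / v i * a i ^ 2 else 0) +
          if G.Adj i j then (v j + v i) / v j * a j ^ 2 else 0) := by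
        rw [dirichletEnergy]
        gcongr with i _ j _
        split_ifs
        · exact key i j
        · simp
    _ = ∑ i, ∑ j, (if G.Adj i j then (v i + v j) / v i * a i ^ 2 else 0) := by
        simp only [Finset.sum_add_distrib]
        rw [hsymm]
        ring
    _ ≤ ∑ i, μ * a i ^ 2 := by
        refine Finset.sum_le_sum fun i _ => ?_
        have h1 : ∑ j, (if G.Adj i j then (v i + v j) / v i * a i ^ 2 else 0) =
            (∑ j, if G.Adj i j then v i + v j else 0) * (a i ^ 2 / v i) := by
          rw [Finset.sum_mul]
          refine Finset.sum_congr rfl fun j _ => ?_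
          split_ifs <;> ring
        rw [h1]
        rcases (hv i).eq_or_lt with hi | hi
        · simp [ha i hi.symm]
        · calc _ ≤ μ * v i * (a i ^ 2 / v i) := by
                gcongr
                exact h i hi
            _ = _ := by field_simp
    _ = _ := by rw [Finset.mul_sum]

/-- On a graph with three distinct edges at `c`, some function has Rayleigh quotient at least
`4`. -/
theorem exists_four_mul_le_dirichletEnergy [DecidableEq B] {c x y z : B} (hx : G.Adj c x)
    (hy : G.Adj c y) (hz : G.Adj c z) (hxy : x ≠ y) (hxz : x ≠ z) (hyz : y ≠ z) :
    ∃ a : B → ℝ, 0 < ∑ i, a i ^ 2 ∧ 4 * ∑ i, a i ^ 2 ≤ dirichletEnergy G a := by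
  have hcx := hx.ne
  have hcy := hy.ne
  have hcz := hz.ne
  -- The top Laplace eigenvector of the star with three leaves, extended by zero: square norm `12`,
  -- and three edges contribute `16` each. Further edges only add energy.
  set a : B → ℝ := fun i => if i = c then 3 else if i = x ∨ i = y ∨ i = z then -1 else 0 with ha
  have h1 : ∑ i, a i ^ 2 = 12 := by
    have : ∀ i, a i ^ 2 = (if i = c then 9 else 0) + (if i = x then 1 else 0) +
        (if i = y then 1 else 0) + if i = z then 1 else 0 := by
      intro i
      simp only [ha]
      by_cases h1 : i = c
      · subst h1
        simp [hcx, hcy, hcz]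
        norm_num
      by_cases h2 : i = x
      · subst h2
        simp [h1, hxy, hxz]
      by_cases h3 : i = y
      · subst h3
        simp [h1, h2, hyz]
      by_cases h4 : i = z
      · subst h4
        simp [h1, h2, h3]
      · simp [h1, h2, h3, h4]
    simp only [this, Finset.sum_add_distrib, Finset.sum_ite_eq', Finset.mem_univ, if_true]
    norm_num
  have hac : a c = 3 := by simp [ha]
  have hax : a x = -1 := by simp [ha, hcx.symm]
  have hay : a y = -1 := by simp [ha, hcy.symm]
  have haz : a z = -1 := by simp [ha, hcz.symm]
  refine ⟨a, by rw [h1]; norm_num, ?_⟩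
  rw [h1, dirichletEnergy, ← Finset.sum_product']
  have h2 := Finset.sum_le_sum_of_subset_of_nonneg
    (f := fun p : B × B => if G.Adj p.1 p.2 then (a p.1 - a p.2) ^ 2 else 0)
    (Finset.subset_univ {(c, x), (c, y), (c, z), (x, c), (y, c), (z, c)})
    (fun p _ _ => by positivity)
  rw [Finset.sum_insert (by simp [hxy, hxz, hcx, hcy, hcz]),
    Finset.sum_insert (by simp [hyz, hcx, hcy, hcz]),
    Finset.sum_insert (by simp [hcx, hcy, hcz]), Finset.sum_insert (by simp [hxy, hxz]),
    Finset.sum_insert (by simp [hyz]), Finset.sum_singleton] at h2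
  simp only [hx, hy, hz, hx.symm, hy.symm, hz.symm, if_true, hac, hax, hay, haz] at h2
  simp only [Finset.univ_product_univ]
  linarith

end Spectrum

/-! ### From eigenvalue bounds to the curvature -/

section Criterion

variable {m : ℕ} {W : Type*} [Group W] {M : CoxeterMatrix (Fin m)}

theorem exists_ricciCurvature_eq (cs : CoxeterSystem M W) (hM : IsCrystallographic M) {K L : ℝ}
    (hK : ∀ a, dirichletEnergy (coxeterGraph M) a ≤ (2 - K) * ∑ i, a i ^ 2)
    {a : Fin m → ℝ} (ha : 0 < ∑ i, a i ^ 2)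
    (hL : (2 - L) * ∑ i, a i ^ 2 ≤ dirichletEnergy (coxeterGraph M) a) :
    ∃ r : ℝ, ricciCurvature (weakOrderGraph cs) = r ∧ K ≤ r ∧ r ≤ L := by
  set S : Set ℝ := {K | IsCurvatureBound (weakOrderGraph cs) K} with hS
  have hmem : ∀ k, k ∈ S ↔
      ∀ a : Fin m → ℝ, dirichletEnergy (coxeterGraph M) a ≤ (2 - k) * ∑ i, a i ^ 2 :=
    isCurvatureBound_weakOrderGraph_iff cs hM
  have hKS : K ∈ S := (hmem K).2 hK
  have hub : ∀ k ∈ S, k ≤ L := by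
    intro k hk
    have h1 := hL.trans ((hmem k).1 hk a)
    have := le_of_mul_le_mul_right h1 ha
    linarith
  -- Closedness makes the supremum an attained maximum, as `ricciCurvature_eq_coe_iff` requires.
  have hclosed : IsClosed S := by
    have : S = ⋂ a : Fin m → ℝ,
        {k | dirichletEnergy (coxeterGraph M) a ≤ (2 - k) * ∑ i, a i ^ 2} := by
      ext k
      simp only [hmem, Set.mem_iInter, Set.mem_ofPred_eq]
    rw [this]
    exact isClosed_iInter fun a => isClosed_le (by fun_prop) (by fun_prop)
  have hbdd : BddAbove S := ⟨L, hub⟩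
  have hsup : sSup S ∈ S := hclosed.csSup_mem ⟨K, hKS⟩ hbdd
  exact ⟨sSup S, (ricciCurvature_eq_coe_iff _ _).2 ⟨hsup, fun k hk => le_csSup hbdd hk⟩,
    le_csSup hbdd hKS, hub _ hsup⟩

theorem ricciCurvature_eq (cs : CoxeterSystem M W) (hM : IsCrystallographic M) {K : ℝ}
    (hK : ∀ a, dirichletEnergy (coxeterGraph M) a ≤ (2 - K) * ∑ i, a i ^ 2)
    {a : Fin m → ℝ} (ha : 0 < ∑ i, a i ^ 2)
    (hL : dirichletEnergy (coxeterGraph M) a = (2 - K) * ∑ i, a i ^ 2) :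
    ricciCurvature (weakOrderGraph cs) = (K : EReal) := by
  obtain ⟨r, hr, h1, h2⟩ := exists_ricciCurvature_eq cs hM hK ha hL.ge
  rw [hr, le_antisymm h2 h1]

/-- If the Coxeter graph is bipartite, then a positive eigenvector of its signless Laplacian
determines the curvature. -/
theorem ricciCurvature_eq_of_bipartite [NeZero m] (cs : CoxeterSystem M W)
    (hM : IsCrystallographic M) {ε v : Fin m → ℝ} (hε : ∀ i, ε i ^ 2 = 1)
    (hadj : ∀ i j, (coxeterGraph M).Adj i j → ε j = -ε i) (hv : ∀ i, 0 < v i) {K : ℝ}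
    (h : ∀ i, ∑ j, (if (coxeterGraph M).Adj i j then v i + v j else 0) = (2 - K) * v i) :
    ricciCurvature (weakOrderGraph cs) = (K : EReal) := by
  refine ricciCurvature_eq cs hM (a := fun i => ε i * v i)
    (fun a => dirichletEnergy_le _ (fun i => (hv i).le) (fun i _ => (h i).le)
      fun i hi => absurd hi (hv i).ne') ?_ (dirichletEnergy_of_eigenvector _ fun i => ?_)
  · simp only [mul_pow, hε, one_mul]
    exact Finset.sum_pos (fun i _ => pow_pos (hv i) 2) ⟨0, Finset.mem_univ _⟩
  · rw [mul_left_comm, ← h i, Finset.mul_sum]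
    refine Finset.sum_congr rfl fun j _ => ?_
    split_ifs with hij
    · rw [hadj i j hij]
      ring
    · simp

end Criterion
-- Sums over one or two indices of `Fin N`
theorem sum_fin_ite_val_eq (N k : ℕ) (G : ℕ → ℝ) :
    ∑ j : Fin N, (if (j : ℕ) = k then G j else 0) = if k < N then G k else 0 := by
  rw [Fin.sum_univ_eq_sum_range (fun j => if j = k then G j else 0) N]
  simp

theorem sum_fin_ite_or {N k l : ℕ} (hkl : k ≠ l) (G : ℕ → ℝ) :
    ∑ j : Fin N, (if (j : ℕ) = k ∨ (j : ℕ) = l then G j else 0) =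
      (if k < N then G k else 0) + if l < N then G l else 0 := by
  rw [← sum_fin_ite_val_eq, ← sum_fin_ite_val_eq, ← Finset.sum_add_distrib]
  refine Finset.sum_congr rfl fun j _ => ?_
  by_cases h1 : (j : ℕ) = k
  · have h2 : (j : ℕ) ≠ l := fun h => hkl (h1.symm.trans h)
    simp [h1, hkl]
  · simp [h1]

/-! ### Crystallographic labels -/

theorem isCrystallographic_affineA (n : ℕ) : IsCrystallographic (affineA n) := by
  intro i j
  simp only [affineA, Matrix.of_apply]
  split_ifs <;> simp

theorem isCrystallographic_affineB (n : ℕ) : IsCrystallographic (affineB n) := by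
  intro i j
  simp only [affineB, Matrix.of_apply]
  split_ifs <;> simp

theorem isCrystallographic_affineC (n : ℕ) : IsCrystallographic (affineC n) := by
  intro i j
  simp only [affineC, Matrix.of_apply]
  split_ifs <;> simp

theorem isCrystallographic_affineD (n : ℕ) : IsCrystallographic (affineD n) := by
  intro i j
  simp only [affineD, Matrix.of_apply]
  split_ifs <;> simp

theorem isCrystallographic_affineA₁ : IsCrystallographic affineA₁ := by
  intro i j
  fin_cases i <;> fin_cases j <;> simp [affineA₁]

theorem isCrystallographic_affineF₄ : IsCrystallographic affineF₄ := by
  intro i j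
  fin_cases i <;> fin_cases j <;> simp [affineF₄]

theorem isCrystallographic_affineG₂ : IsCrystallographic affineG₂ := by
  intro i j
  fin_cases i <;> fin_cases j <;> simp [affineG₂]

theorem isCrystallographic_affineE₆ : IsCrystallographic affineE₆ := by
  intro i j
  fin_cases i <;> fin_cases j <;> simp [affineE₆]

theorem isCrystallographic_affineE₇ : IsCrystallographic affineE₇ := by
  intro i j
  fin_cases i <;> fin_cases j <;> simp [affineE₇]

theorem isCrystallographic_affineE₈ : IsCrystallographic affineE₈ := by
  intro i j
  fin_cases i <;> fin_cases j <;> simp [affineE₈]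

/-! ### Coxeter graphs which are paths -/

section Path

/-- The Coxeter graph of `M` is the path `0 - 1 - ⋯ - (m - 1)`. -/
def IsPathLike {m : ℕ} (M : CoxeterMatrix (Fin m)) : Prop :=
  ∀ i j : Fin m, (coxeterGraph M).Adj i j ↔ (j : ℕ) = i + 1 ∨ (j : ℕ) + 1 = i

theorem isPathLike_affineC (n : ℕ) : IsPathLike (affineC n) := by
  intro i j
  simp only [coxeterGraph, affineC, Matrix.of_apply, Fin.ext_iff, ne_eq]
  split_ifs <;> simp <;> omega

theorem isPathLike_affineA₁ : IsPathLike affineA₁ := by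
  unfold IsPathLike; decide

theorem isPathLike_affineF₄ : IsPathLike affineF₄ := by
  unfold IsPathLike; decide

theorem isPathLike_affineG₂ : IsPathLike affineG₂ := by
  unfold IsPathLike; decide

theorem ricciCurvature_of_isPathLike {m : ℕ} (hm : 2 ≤ m) {W : Type*} [Group W]
    {M : CoxeterMatrix (Fin m)} (hpath : IsPathLike M) (hM : IsCrystallographic M)
    (cs : CoxeterSystem M W) :
    ricciCurvature (weakOrderGraph cs) = ((-2 * Real.cos (Real.pi / (m : ℝ)) : ℝ) : EReal) := by
  unfold IsPathLike at hpath
  have : NeZero m := ⟨by omega⟩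
  have hm0 : (0 : ℝ) < m := by exact_mod_cast (by omega : 0 < m)
  set θ : ℝ := Real.pi / m with hθ
  have hmθ : m * θ = Real.pi := by rw [hθ]; field_simp
  have hθ0 : 0 < θ := div_pos Real.pi_pos hm0
  -- The half-integer shift makes `S` odd about `-1/2` and about `m - 1/2`, so the ghost neighbours
  -- at `-1` and `m` contribute `S i + S (ghost) = 0`. The recurrence thus gives the signless
  -- eigenvalue `2 + 2 cos θ` at the endpoints too.
  set S : ℝ → ℝ := fun x => Real.sin ((x + 1 / 2) * θ) with hS
  have hrec : ∀ x, S (x + 1) + S (x - 1) = 2 * Real.cos θ * S x := by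
    intro x
    simp only [hS]
    rw [show (x + 1 + 1 / 2) * θ = (x + 1 / 2) * θ + θ by ring,
      show (x - 1 + 1 / 2) * θ = (x + 1 / 2) * θ - θ by ring, Real.sin_add, Real.sin_sub]
    ring
  have hfirst : S (0 - 1) = -S 0 := by
    simp only [hS]
    rw [← Real.sin_neg]
    congr 1
    ring
  have hlast : S (m - 1 + 1) = -S (m - 1) := by
    simp only [hS]
    rw [show ((m : ℝ) - 1 + 1 + 1 / 2) * θ = 1 / 2 * θ + Real.pi by linear_combination hmθ,
      show ((m : ℝ) - 1 + 1 / 2) * θ = Real.pi - 1 / 2 * θ by linear_combination hmθ,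
      Real.sin_add_pi, Real.sin_pi_sub]
  refine ricciCurvature_eq_of_bipartite cs hM (ε := fun i => (-1) ^ (i : ℕ))
    (v := fun i => S (i : ℕ)) (fun i => ?_) (fun i j hij => ?_) (fun i => ?_) fun i => ?_
  · rw [← pow_mul, mul_comm, pow_mul]
    norm_num
  · rcases (hpath i j).1 hij with h | h
    · rw [h, pow_succ]
      ring
    · rw [← h, pow_succ]
      ring
  · have hi : (i : ℝ) + 1 ≤ m := by exact_mod_cast i.2
    refine Real.sin_pos_of_pos_of_lt_pi (by positivity) ?_
    rw [← hmθ]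
    gcongr
    linarith
  · have h1 : ∀ j : Fin m, (if (coxeterGraph M).Adj i j then S (i : ℕ) + S (j : ℕ) else 0) =
        (if (j : ℕ) = i + 1 then S (i : ℕ) + S (j : ℕ) else 0) +
          if (j : ℕ) + 1 = i then S (i : ℕ) + S (j : ℕ) else 0 := by
      intro j
      simp only [hpath]
      by_cases h : (j : ℕ) = i + 1
      · have h' : ¬ (i : ℕ) + 1 + 1 = i := by omega
        simp [h, h']
      · simp [h]
    have h2 : ∑ j : Fin m, (if (j : ℕ) = i + 1 then S (i : ℕ) + S (j : ℕ) else 0) =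
        S (i : ℕ) + S ((i : ℕ) + 1) := by
      rw [sum_fin_ite_val_eq m (i + 1) (fun k => S (i : ℕ) + S k)]
      split_ifs with h
      · push_cast
        rfl
      · have : (i : ℝ) = m - 1 := by
          have : ((i : ℕ) : ℝ) + 1 = m := by exact_mod_cast (by omega : (i : ℕ) + 1 = m)
          linarith
        rw [this, hlast]
        ring
    have h3 : ∑ j : Fin m, (if (j : ℕ) + 1 = i then S (i : ℕ) + S (j : ℕ) else 0) =
        S (i : ℕ) + S ((i : ℕ) - 1) := by
      rcases Nat.eq_zero_or_pos (i : ℕ) with h | h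
      · simp only [h, Nat.add_eq_zero_iff, one_ne_zero, and_false, if_false,
          Finset.sum_const_zero, Nat.cast_zero]
        rw [hfirst]
        ring
      · obtain ⟨k, hk⟩ : ∃ k, (i : ℕ) = k + 1 := ⟨i - 1, by omega⟩
        simp only [hk, add_left_inj]
        rw [sum_fin_ite_val_eq m k (fun l => S ((k + 1 : ℕ) : ℝ) + S l), if_pos (by omega)]
        push_cast
        ring_nf
    simp only [h1, Finset.sum_add_distrib, h2, h3]
    linear_combination hrec (i : ℕ)

theorem ricciCurvature_of_isLinearAffine {m : ℕ} {W : Type*} [Group W]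
    {M : CoxeterMatrix (Fin m)} (h : IsLinearAffine M) (cs : CoxeterSystem M W) :
    ricciCurvature (weakOrderGraph cs) =
      ((-2 * Real.cos (Real.pi / ((Set.range cs.simple).ncard : ℝ)) : ℝ) : EReal) := by
  have key : 2 ≤ m ∧ IsPathLike M ∧ IsCrystallographic M := by
    cases h with
    | C n hn => exact ⟨by omega, isPathLike_affineC n, isCrystallographic_affineC n⟩
    | F₄ => exact ⟨by omega, isPathLike_affineF₄, isCrystallographic_affineF₄⟩
    | G₂ => exact ⟨by omega, isPathLike_affineG₂, isCrystallographic_affineG₂⟩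
    | A₁ => exact ⟨by omega, isPathLike_affineA₁, isCrystallographic_affineA₁⟩
  obtain ⟨hm, hpath, hM⟩ := key
  rw [← Set.image_univ, Set.ncard_image_of_injective _ (simple_injective cs hM), Set.ncard_univ,
    Nat.card_fin]
  exact ricciCurvature_of_isPathLike hm hpath hM cs

end Path

/-! ### Coxeter graphs which are cycles -/

section Cycle

theorem coxeterGraph_affineA_adj {n : ℕ} (hn : 3 ≤ n) (i j : Fin n) :
    (coxeterGraph (affineA n)).Adj i j ↔
      (j : ℕ) = (i + 1) % n ∨ (j : ℕ) = (i + (n - 1)) % n := by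
  have key : ∀ k : ℕ, k < n → ((k + 1) % n = if k + 1 = n then 0 else k + 1) ∧
      ((k + (n - 1)) % n = if k = 0 then n - 1 else k - 1) := by
    intro k hk
    constructor
    · split_ifs with h
      · rw [h, Nat.mod_self]
      · exact Nat.mod_eq_of_lt (by omega)
    · split_ifs with h
      · rw [h, zero_add]
        exact Nat.mod_eq_of_lt (by omega)
      · rw [show k + (n - 1) = k - 1 + n by omega, Nat.add_mod_right]
        exact Nat.mod_eq_of_lt (by omega)
  obtain ⟨h1, h2⟩ := key i i.2
  obtain ⟨h3, -⟩ := key j j.2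
  have hi := i.2
  have hj := j.2
  simp only [coxeterGraph, affineA, Matrix.of_apply, Fin.ext_iff, ne_eq, h1, h2, h3]
  split_ifs <;> simp <;> omega

theorem sum_coxeterGraph_affineA {n : ℕ} (hn : 3 ≤ n) (i : Fin n) (G : ℕ → ℝ) :
    ∑ j : Fin n, (if (coxeterGraph (affineA n)).Adj i j then G j else 0) =
      G ((i + 1) % n) + G ((i + (n - 1)) % n) := by
  simp only [coxeterGraph_affineA_adj hn]
  rw [sum_fin_ite_or, if_pos (Nat.mod_lt _ (by omega)), if_pos (Nat.mod_lt _ (by omega))]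
  -- The two neighbours would coincide only if `1 = n - 1` modulo `n`, which `3 ≤ n` excludes.
  intro h
  have : (i + 1) ≡ (i + (n - 1)) [MOD n] := h
  have h2 := (Nat.ModEq.add_left_cancel' _ this)
  rw [Nat.ModEq, Nat.mod_eq_of_lt (by omega), Nat.mod_eq_of_lt (by omega)] at h2
  omega

theorem cos_mod_mul {n q : ℕ} {φ : ℝ} (h : n * φ = q * (2 * Real.pi)) (k : ℕ) :
    Real.cos ((k % n : ℕ) * φ) = Real.cos (k * φ) := by
  have h1 : (k : ℝ) = (k % n : ℕ) + n * (k / n : ℕ) := by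
    exact_mod_cast (Nat.mod_add_div k n).symm
  have h2 : (k : ℝ) * φ = (k % n : ℕ) * φ + (k / n * q : ℕ) * (2 * Real.pi) := by
    rw [h1]
    push_cast
    linear_combination (((k / n : ℕ) : ℝ)) * h
  rw [h2, Real.cos_add_nat_mul_two_pi]

theorem cos_eigenvector_affineA {n q : ℕ} (hn : 3 ≤ n) {φ : ℝ} (h : n * φ = q * (2 * Real.pi))
    (i : Fin n) : ∑ j : Fin n, (if (coxeterGraph (affineA n)).Adj i j then
      Real.cos ((i : ℕ) * φ) - Real.cos ((j : ℕ) * φ) else 0) =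
        (2 - 2 * Real.cos φ) * Real.cos ((i : ℕ) * φ) := by
  rw [sum_coxeterGraph_affineA hn i fun k => Real.cos ((i : ℕ) * φ) - Real.cos (k * φ),
    cos_mod_mul h, cos_mod_mul h]
  have h1 : ((i + 1 : ℕ) : ℝ) * φ = (i : ℕ) * φ + φ := by
    push_cast
    ring
  have h2 : ((i + (n - 1) : ℕ) : ℝ) * φ = (i : ℕ) * φ - φ + q * (2 * Real.pi) := by
    rw [Nat.cast_add, Nat.cast_sub (by omega)]
    push_cast
    linear_combination h
  rw [h1, h2, Real.cos_add_nat_mul_two_pi, Real.cos_add, Real.cos_sub]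
  ring

theorem dirichletEnergy_affineA_le_four {n : ℕ} (hn : 3 ≤ n) (a : Fin n → ℝ) :
    dirichletEnergy (coxeterGraph (affineA n)) a ≤ 4 * ∑ i, a i ^ 2 := by
  refine dirichletEnergy_le _ (v := fun _ => 1) (fun _ => zero_le_one) (fun i _ => ?_)
    fun i hi => absurd hi one_ne_zero
  rw [sum_coxeterGraph_affineA hn i fun _ => 1 + 1]
  norm_num

/-- Subtracting `a 0` times the eigenvector `cos (i φ)`, which equals `1` at vertex `0`, leaves `μ ∑
a² - E(a)` unchanged, with `μ = 2 - 2 cos φ` and `E` the Dirichlet energy. The new function vanishes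
at `0`. On the remaining path `sin (i θ)` is positive with signless eigenvalue `2 + 2 cos θ = μ`. -/
theorem dirichletEnergy_affineA_le_of_odd {n q : ℕ} (hn : 3 ≤ n) (hq : n + 1 = 2 * q) {θ φ : ℝ}
    (hθ : n * θ = Real.pi) (hφ : φ = θ + Real.pi) (a : Fin n → ℝ) :
    dirichletEnergy (coxeterGraph (affineA n)) a ≤ (2 - 2 * Real.cos φ) * ∑ i, a i ^ 2 := by
  have hnφ : n * φ = q * (2 * Real.pi) := by
    have : (n : ℝ) + 1 = 2 * q := by exact_mod_cast hq
    rw [hφ]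
    linear_combination hθ + Real.pi * this
  have hn0 : (0 : ℝ) < n := by exact_mod_cast (by omega : 0 < n)
  have hθ0 : 0 < θ := pos_of_mul_pos_right (hθ ▸ Real.pi_pos) hn0.le
  have : NeZero n := ⟨by omega⟩
  have hshift := sub_dirichletEnergy_sub_smul _
    (w := fun i : Fin n => Real.cos ((i : ℕ) * φ)) (cos_eigenvector_affineA hn hnφ) a (a 0)
  rw [← sub_nonneg, ← hshift, sub_nonneg]
  have hpos : ∀ i : Fin n, (i : ℕ) ≠ 0 → 0 < Real.sin ((i : ℕ) * θ) := by
    intro i hi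
    have h0 : (0 : ℝ) < (i : ℕ) := by exact_mod_cast Nat.pos_of_ne_zero hi
    refine Real.sin_pos_of_pos_of_lt_pi (by positivity) ?_
    rw [← hθ]
    gcongr
    exact i.2
  have hzero : ∀ i : Fin n, (i : ℕ) = 0 → Real.sin ((i : ℕ) * θ) = 0 := by
    intro i hi
    simp [hi]
  refine dirichletEnergy_le _ (v := fun i : Fin n => Real.sin ((i : ℕ) * θ)) (fun i => ?_)
    (fun i hi => ?_) fun i hi => ?_
  · by_cases h : (i : ℕ) = 0
    · exact (hzero i h).ge
    · exact (hpos i h).le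
  · have hi0 : (i : ℕ) ≠ 0 := fun h => hi.ne' (hzero i h)
    rw [sum_coxeterGraph_affineA hn i fun k => Real.sin ((i : ℕ) * θ) + Real.sin (k * θ)]
    have h1 : Real.sin (((i + 1) % n : ℕ) * θ) = Real.sin ((i : ℕ) * θ + θ) := by
      rcases eq_or_ne ((i : ℕ) + 1) n with h | h
      · rw [h, Nat.mod_self, Nat.cast_zero, zero_mul, Real.sin_zero]
        have : ((i : ℕ) : ℝ) * θ + θ = Real.pi := by
          have h' : ((i : ℕ) : ℝ) + 1 = n := by exact_mod_cast h
          rw [← hθ, ← h']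
          ring
        rw [this, Real.sin_pi]
      · rw [Nat.mod_eq_of_lt (by omega)]
        congr 1
        push_cast
        ring
    have h2 : Real.sin (((i + (n - 1)) % n : ℕ) * θ) = Real.sin ((i : ℕ) * θ - θ) := by
      rw [show (i : ℕ) + (n - 1) = i - 1 + n by omega, Nat.add_mod_right,
        Nat.mod_eq_of_lt (by omega), Nat.cast_sub (by omega)]
      congr 1
      push_cast
      ring
    rw [h1, h2, hφ, Real.cos_add_pi, Real.sin_add, Real.sin_sub]
    apply le_of_eq
    ring
  · have hi0 : i = 0 := by
      by_contra h
      exact (hpos i (fun h' => h (Fin.ext h'))).ne' hi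
    simp [hi0]

theorem ricciCurvature_affineA {n : ℕ} (hn : 3 ≤ n) {W : Type*} [Group W]
    (cs : CoxeterSystem (affineA n) W) :
    ricciCurvature (weakOrderGraph cs) =
      ((2 * Real.cos (2 * Real.pi / (n : ℝ) * (⌈(n : ℝ) / 2⌉ : ℝ)) : ℝ) : EReal) := by
  have hn0 : (n : ℝ) ≠ 0 := by exact_mod_cast (by omega : n ≠ 0)
  -- The frequency nearest to `π`: with `q = ⌈n / 2⌉` the angle `φ` is `π` for even `n` and `π + π /
  -- n` for odd `n`.
  obtain ⟨q, hq⟩ : ∃ q : ℕ, n = 2 * q ∨ n + 1 = 2 * q := ⟨(n + 1) / 2, by omega⟩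
  have hceil : ⌈(n : ℝ) / 2⌉ = (q : ℤ) := by
    rw [Int.ceil_eq_iff]
    rcases hq with h | h
    · have : (n : ℝ) = 2 * q := by exact_mod_cast h
      push_cast
      constructor <;> linarith
    · have : (n : ℝ) + 1 = 2 * q := by exact_mod_cast h
      push_cast
      constructor <;> linarith
  rw [hceil, Int.cast_natCast]
  set φ : ℝ := 2 * Real.pi / n * q with hφ
  have hnφ : n * φ = q * (2 * Real.pi) := by
    rw [hφ]
    field_simp
  have : NeZero n := ⟨by omega⟩
  refine ricciCurvature_eq cs (isCrystallographic_affineA n) (fun a => ?_) ?_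
    (dirichletEnergy_of_eigenvector _ (w := fun i : Fin n => Real.cos ((i : ℕ) * φ))
      (cos_eigenvector_affineA hn hnφ))
  · rcases hq with h | h
    · have h' : (n : ℝ) = 2 * q := by exact_mod_cast h
      have : φ = Real.pi := by
        refine mul_left_cancel₀ hn0 ?_
        rw [hnφ, h']
        ring
      rw [this, Real.cos_pi]
      convert dirichletEnergy_affineA_le_four hn a using 2
      norm_num
    · have h' : (n : ℝ) + 1 = 2 * q := by exact_mod_cast h
      refine dirichletEnergy_affineA_le_of_odd hn h (θ := Real.pi / n) (by field_simp) ?_ a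
      refine mul_left_cancel₀ hn0 ?_
      rw [hnφ, mul_add, mul_div_cancel₀ _ hn0]
      linear_combination -Real.pi * h'
  · have h0 : (0 : ℝ) < Real.cos (((0 : Fin n) : ℕ) * φ) ^ 2 := by simp
    exact h0.trans_le (Finset.single_le_sum (f := fun i : Fin n => Real.cos ((i : ℕ) * φ) ^ 2)
      (fun i _ => sq_nonneg _) (Finset.mem_univ 0))

end Cycle
/-! ### Types B and D -/

section Branched

/-- The constant weight `1` gives twice the maximal degree, here at most `3`; the indices `k`, `l`,
`p` need only cover the neighbours. -/
theorem dirichletEnergy_le_six {m : ℕ} {G : SimpleGraph (Fin m)} [DecidableRel G.Adj]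
    (h : ∀ i, ∃ k l p : ℕ, ∀ j, G.Adj i j → (j : ℕ) = k ∨ (j : ℕ) = l ∨ (j : ℕ) = p)
    (a : Fin m → ℝ) : dirichletEnergy G a ≤ 6 * ∑ i, a i ^ 2 := by
  refine dirichletEnergy_le _ (v := fun _ => 1) (fun _ => zero_le_one) (fun i _ => ?_)
    fun i hi => absurd hi one_ne_zero
  obtain ⟨k, l, p, h⟩ := h i
  have hle (q : ℕ) : ∑ j : Fin m, (if (j : ℕ) = q then (2 : ℝ) else 0) ≤ 2 := by
    rw [sum_fin_ite_val_eq m q fun _ => 2]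
    split_ifs <;> norm_num
  calc ∑ j, (if G.Adj i j then (1 + 1 : ℝ) else 0)
      ≤ ∑ j : Fin m, ((if (j : ℕ) = k then 2 else 0) + (if (j : ℕ) = l then 2 else 0) +
          if (j : ℕ) = p then 2 else 0) := by
        refine Finset.sum_le_sum fun j _ => ?_
        split_ifs with h1 <;> norm_num
        have := h j h1
        tauto
    _ ≤ 6 * 1 := by
        simp only [Finset.sum_add_distrib]
        linarith [hle k, hle l, hle p]

theorem exists_ricciCurvature_affineB {n : ℕ} (hn : 3 ≤ n) {W : Type*} [Group W]
    (cs : CoxeterSystem (affineB n) W) :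
    ∃ r : ℝ, ricciCurvature (weakOrderGraph cs) = r ∧ -4 ≤ r ∧ r ≤ -2 := by
  have hdeg : ∀ i : Fin (n + 1), ∃ k l p : ℕ, ∀ j, (coxeterGraph (affineB n)).Adj i j →
      (j : ℕ) = k ∨ (j : ℕ) = l ∨ (j : ℕ) = p := by
    intro i
    -- The list may contain non-neighbours: at `i = 0` truncated subtraction gives `0`, and at `i =
    -- n` the value `i + 1` is out of range. Both are harmless.
    refine ⟨if (i : ℕ) = 2 then 0 else i - 1, i + 1, if (i : ℕ) = 2 then 1 else 2, fun j => ?_⟩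
    rintro ⟨h1, h2⟩
    simp only [affineB, Matrix.of_apply, Fin.ext_iff, ne_eq] at h1 h2
    split_ifs at h2 ⊢ <;> omega
  have hadj : ∀ k : ℕ, ∀ hk : k < n + 1, k ≤ 3 → k ≠ 2 →
      (coxeterGraph (affineB n)).Adj ⟨2, by omega⟩ ⟨k, hk⟩ := by
    intro k hk h1 h2
    simp only [coxeterGraph, affineB, Matrix.of_apply, Fin.ext_iff, ne_eq]
    refine ⟨by omega, ?_⟩
    split_ifs <;> grind
  obtain ⟨a, ha, h⟩ := exists_four_mul_le_dirichletEnergy _ (hadj 0 (by omega) (by omega)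
    (by omega)) (hadj 1 (by omega) (by omega) (by omega)) (hadj 3 (by omega) (by omega) (by omega))
    (by simp) (by simp) (by simp)
  refine exists_ricciCurvature_eq cs (isCrystallographic_affineB n) (fun b => ?_) ha ?_
  · convert dirichletEnergy_le_six hdeg b using 2
    norm_num
  · convert h using 2
    norm_num

theorem exists_ricciCurvature_affineD {n : ℕ} (hn : 5 ≤ n) {W : Type*} [Group W]
    (cs : CoxeterSystem (affineD n) W) :
    ∃ r : ℝ, ricciCurvature (weakOrderGraph cs) = r ∧ -4 ≤ r ∧ r ≤ -2 := by
  have hdeg : ∀ i : Fin (n + 1), ∃ k l p : ℕ, ∀ j, (coxeterGraph (affineD n)).Adj i j →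
      (j : ℕ) = k ∨ (j : ℕ) = l ∨ (j : ℕ) = p := by
    intro i
    -- For `n ≥ 5` the branch vertices `2` and `n - 2` are distinct, so three candidates suffice;
    -- for `n = 4` they merge into a vertex of degree four.
    refine ⟨if (i : ℕ) = 2 then 0 else i - 1, i + 1,
      if (i : ℕ) = 2 then 1 else if (i : ℕ) < 2 then 2 else if (i : ℕ) + 2 = n then n else n - 2,
      fun j => ?_⟩
    rintro ⟨h1, h2⟩
    simp only [affineD, Matrix.of_apply, Fin.ext_iff, ne_eq] at h1 h2
    split_ifs at h2 ⊢ <;> omega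
  have hadj : ∀ k : ℕ, ∀ hk : k < n + 1, k ≤ 3 → k ≠ 2 →
      (coxeterGraph (affineD n)).Adj ⟨2, by omega⟩ ⟨k, hk⟩ := by
    intro k hk h1 h2
    simp only [coxeterGraph, affineD, Matrix.of_apply, Fin.ext_iff, ne_eq]
    refine ⟨by omega, ?_⟩
    split_ifs <;> grind
  obtain ⟨a, ha, h⟩ := exists_four_mul_le_dirichletEnergy _ (hadj 0 (by omega) (by omega)
    (by omega)) (hadj 1 (by omega) (by omega) (by omega)) (hadj 3 (by omega) (by omega) (by omega))
    (by simp) (by simp) (by simp)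
  refine exists_ricciCurvature_eq cs (isCrystallographic_affineD n) (fun b => ?_) ha ?_
  · convert dirichletEnergy_le_six hdeg b using 2
    norm_num
  · convert h using 2
    norm_num

theorem ricciCurvature_affineD_four {W : Type*} [Group W] (cs : CoxeterSystem (affineD 4) W) :
    ricciCurvature (weakOrderGraph cs) = ((-3 : ℝ) : EReal) := by
  have hadj : ∀ i j : Fin 5, (coxeterGraph (affineD 4)).Adj i j ↔
      (i = 2 ∧ j ≠ 2) ∨ (i ≠ 2 ∧ j = 2) := by decide
  -- The graph is a star with four leaves; the weights `4` and `1` have signless eigenvalue `5`,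
  -- since `4 * (4 + 1) = 5 * 4` at the centre and `1 + 4 = 5` at a leaf.
  refine ricciCurvature_eq_of_bipartite cs (isCrystallographic_affineD 4)
    (ε := fun i => if i = 2 then -1 else 1) (v := fun i => if i = 2 then 4 else 1)
    (fun i => ?_) (fun i j hij => ?_) (fun i => ?_) fun i => ?_
  · split_ifs <;> norm_num
  · rcases (hadj i j).1 hij with ⟨h1, h2⟩ | ⟨h1, h2⟩ <;> simp [h1, h2]
  · split_ifs <;> norm_num
  · simp only [hadj]
    fin_cases i <;> simp [Fin.sum_univ_five] <;> norm_num

end Branched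

/-! ### Type E -/

section Exceptional

/-- A positive subsolution `v` of the signless Laplacian and a test vector `a` enclose the
curvature. -/
theorem exists_ricciCurvature_eq_of_pos {m : ℕ} {W : Type*} [Group W]
    {M : CoxeterMatrix (Fin m)} (cs : CoxeterSystem M W) (hM : IsCrystallographic M) {K L : ℝ}
    {v a : Fin m → ℝ} (hv : ∀ i, 0 < v i)
    (hK : ∀ i, ∑ j, (if (coxeterGraph M).Adj i j then v i + v j else 0) ≤ (2 - K) * v i)
    (ha : 0 < ∑ i, a i ^ 2)
    (hL : (2 - L) * ∑ i, a i ^ 2 ≤ dirichletEnergy (coxeterGraph M) a) :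
    ∃ r : ℝ, ricciCurvature (weakOrderGraph cs) = r ∧ K ≤ r ∧ r ≤ L :=
  exists_ricciCurvature_eq cs hM (fun _ => dirichletEnergy_le _ (fun i => (hv i).le)
    (fun i _ => hK i) fun i hi => absurd hi (hv i).ne') ha hL

theorem exists_ricciCurvature_affineE₆ {W : Type*} [Group W] (cs : CoxeterSystem affineE₆ W) :
    ∃ r : ℝ, ricciCurvature (weakOrderGraph cs) = r ∧ -2.415 < r ∧ r ≤ -2.414 := by
  -- The vector `v` is an integer approximation to the Perron eigenvector of the signless Laplacian,
  -- and `a` is `v` with signs alternating along the bipartition. `K` is taken slightly above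
  -- `-2.415` so that the lower inequality is strict. The types `Ẽ₇` and `Ẽ₈` follow the same
  -- pattern.
  obtain ⟨r, hr, h1, h2⟩ := exists_ricciCurvature_eq_of_pos cs isCrystallographic_affineE₆
    (K := -2.4149) (L := -2.414) (v := ![500, 1707, 3621, 1707, 500, 1707, 500])
    (a := ![500, -1707, 3621, -1707, 500, -1707, 500])
    (by intro i; fin_cases i <;> norm_num)
    (by intro i; fin_cases i <;> simp [Fin.sum_univ_succ, coxeterGraph, affineE₆] <;> norm_num)
    (by simp [Fin.sum_univ_succ]; norm_num)
    (by simp [dirichletEnergy, Fin.sum_univ_succ, coxeterGraph, affineE₆]; norm_num)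
  exact ⟨r, hr, by linarith, h2⟩

theorem exists_ricciCurvature_affineE₇ {W : Type*} [Group W] (cs : CoxeterSystem affineE₇ W) :
    ∃ r : ℝ, ricciCurvature (weakOrderGraph cs) = r ∧ -2.37 < r ∧ r ≤ -2.36 := by
  obtain ⟨r, hr, h1, h2⟩ := exists_ricciCurvature_eq_of_pos cs isCrystallographic_affineE₇
    (K := -2.364) (L := -2.36) (v := ![50, 168, 347, 652, 347, 168, 50, 194])
    (a := ![-50, 168, -347, 652, -347, 168, -50, -194])
    (by intro i; fin_cases i <;> norm_num)
    (by intro i; fin_cases i <;> simp [Fin.sum_univ_succ, coxeterGraph, affineE₇] <;> norm_num)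
    (by simp [Fin.sum_univ_succ]; norm_num)
    (by simp [dirichletEnergy, Fin.sum_univ_succ, coxeterGraph, affineE₇]; norm_num)
  exact ⟨r, hr, by linarith, h2⟩

theorem exists_ricciCurvature_affineE₈ {W : Type*} [Group W] (cs : CoxeterSystem affineE₈ W) :
    ∃ r : ℝ, ricciCurvature (weakOrderGraph cs) = r ∧ -2.35 < r ∧ r ≤ -2.34 := by
  obtain ⟨r, hr, h1, h2⟩ := exists_ricciCurvature_eq_of_pos cs isCrystallographic_affineE₈
    (K := -2.348) (L := -2.34) (v := ![301, 1006, 2059, 1149, 636, 342, 167, 50, 615])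
    (a := ![301, -1006, 2059, -1149, 636, -342, 167, -50, -615])
    (by intro i; fin_cases i <;> norm_num)
    (by intro i; fin_cases i <;> simp [Fin.sum_univ_succ, coxeterGraph, affineE₈] <;> norm_num)
    (by simp [Fin.sum_univ_succ]; norm_num)
    (by simp [dirichletEnergy, Fin.sum_univ_succ, coxeterGraph, affineE₈]; norm_num)
  exact ⟨r, hr, by linarith, h2⟩

end Exceptional
end WeakOrderCurvature

theorem mainTheorem5 {W : Type*} [Group W] :
    -- every weak order graph of an affine Weyl group is locally finite
    (∀ (m : ℕ) (M : CoxeterMatrix (Fin m)), WeakOrderCurvature.IsAffineWeyl M →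
      ∀ cs : CoxeterSystem M W,
        WeakOrderCurvature.IsLocallyFinite (WeakOrderCurvature.weakOrderGraph cs)) ∧
    -- type Ã with n generators (the Coxeter graph is an n-cycle)
    (∀ n : ℕ, 3 ≤ n →
      ∀ cs : CoxeterSystem (WeakOrderCurvature.affineA n) W,
        WeakOrderCurvature.ricciCurvature (WeakOrderCurvature.weakOrderGraph cs) =
          ((2 * Real.cos (2 * Real.pi / (n : ℝ) * (⌈(n : ℝ) / 2⌉ : ℝ)) : ℝ) : EReal)) ∧
    -- types C̃_n, F̃₄, G̃₂, Ã₁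
    (∀ (m : ℕ) (M : CoxeterMatrix (Fin m)), WeakOrderCurvature.IsLinearAffine M →
      ∀ cs : CoxeterSystem M W,
        WeakOrderCurvature.ricciCurvature (WeakOrderCurvature.weakOrderGraph cs) =
          ((-2 * Real.cos (Real.pi / ((Set.range cs.simple).ncard : ℝ)) : ℝ) : EReal)) ∧
    -- type B̃_n
    (∀ n : ℕ, 3 ≤ n →
      ∀ cs : CoxeterSystem (WeakOrderCurvature.affineB n) W,
        ∃ r : ℝ, WeakOrderCurvature.ricciCurvature (WeakOrderCurvature.weakOrderGraph cs) = r ∧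
          -4 ≤ r ∧ r ≤ -2) ∧
    -- type D̃_n for n ≥ 5
    (∀ n : ℕ, 5 ≤ n →
      ∀ cs : CoxeterSystem (WeakOrderCurvature.affineD n) W,
        ∃ r : ℝ, WeakOrderCurvature.ricciCurvature (WeakOrderCurvature.weakOrderGraph cs) = r ∧
          -4 ≤ r ∧ r ≤ -2) ∧
    -- type D̃₄
    (∀ cs : CoxeterSystem (WeakOrderCurvature.affineD 4) W,
        WeakOrderCurvature.ricciCurvature (WeakOrderCurvature.weakOrderGraph cs) =
          ((-3 : ℝ) : EReal)) ∧
    -- type Ẽ₆: the decimal expansion of the curvature starts with -2.414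
    (∀ cs : CoxeterSystem WeakOrderCurvature.affineE₆ W,
        ∃ r : ℝ, WeakOrderCurvature.ricciCurvature (WeakOrderCurvature.weakOrderGraph cs) = r ∧
          -2.415 < r ∧ r ≤ -2.414) ∧
    -- type Ẽ₇: the decimal expansion of the curvature starts with -2.36
    (∀ cs : CoxeterSystem WeakOrderCurvature.affineE₇ W,
        ∃ r : ℝ, WeakOrderCurvature.ricciCurvature (WeakOrderCurvature.weakOrderGraph cs) = r ∧
          -2.37 < r ∧ r ≤ -2.36) ∧
    -- type Ẽ₈: the decimal expansion of the curvature starts with -2.34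
    (∀ cs : CoxeterSystem WeakOrderCurvature.affineE₈ W,
        ∃ r : ℝ, WeakOrderCurvature.ricciCurvature (WeakOrderCurvature.weakOrderGraph cs) = r ∧
          -2.35 < r ∧ r ≤ -2.34) := by
  refine ⟨?_, ?_, ?_, ?_, ?_, ?_, ?_, ?_, ?_⟩
  · exact fun m M _ cs => WeakOrderCurvature.isLocallyFinite_weakOrderGraph cs
  · exact fun n hn cs => WeakOrderCurvature.ricciCurvature_affineA hn cs
  · exact fun m M hM cs => WeakOrderCurvature.ricciCurvature_of_isLinearAffine hM cs
  · exact fun n hn cs => WeakOrderCurvature.exists_ricciCurvature_affineB hn cs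
  · exact fun n hn cs => WeakOrderCurvature.exists_ricciCurvature_affineD hn cs
  · exact fun cs => WeakOrderCurvature.ricciCurvature_affineD_four cs
  · exact fun cs => WeakOrderCurvature.exists_ricciCurvature_affineE₆ cs
  · exact fun cs => WeakOrderCurvature.exists_ricciCurvature_affineE₇ cs
  · exact fun cs => WeakOrderCurvature.exists_ricciCurvature_affineE₈ cs
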